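/- Let $(Q_n)_{n\ge 0}$ be the Yablonskii--Vorob'ev polynomials: $Q_0=1$, $Q_1=z$ and $$Q_{n+1}Q_{n-1}=zQ_n^2-4\bigl(Q_nQ_n''-(Q_n')^2\bigr)\qquad(n\ge 1).$$ This recurrence indeed determines polynomials $Q_n\in\mathbb{Q}[z]$, i.e. at each step the right-hand side is divisible by $Q_{n-1}$. For $n,m\ge 0$ put $$S_m(n)=\sum_{z\ne 0,\ Q_n(z)=0}\frac1{z^m},$$ the sum being over the nonzero complex roots of $Q_n$, counted with multiplicity. Then for all integers $n\ge 0$: $$S_3(n)=\begin{cases}\frac n4& n\equiv 0 \pmod 3,\\ 0& n\equiv 1\pmod 3,\\ -\frac{n+1}4& n\equiv 2\pmod 3,\end{cases}$$ $$S_6(n)=\begin{cases}\frac1{40}n^2+\frac1{80}n& n\equiv 0 \pmod 3,\\ -\frac1{560}n^2-\frac1{560}n+\frac1{280}& n\equiv 1\pmod 3,\\ \frac1{40}n^2+\frac3{80}n+\frac1{80}& n\equiv 2\pmod 3,\end{cases}$$ $$S_9(n)=\begin{cases}\frac{n+7n^2+10n^3}{4480}& n\equiv 0 \pmod 3,\\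 \frac{2-n-n^2}{22400}& n\equiv 1\pmod 3,\\ \frac{-20-85n-115n^2-50n^3}{22400}& n\equiv 2\pmod 3.\end{cases}$$ Moreover, for every positive multiple $m$ of $3$ and every $r\in\{0,1,2\}$ there is a polynomial $P_{m,r}$ with rational coefficients such that $S_m(n)=P_{m,r}(n)$ for all $n\ge 0$ with $n\equiv r\pmod 3$; for every $m\ge 0$ not divisible by $3$, $S_m(n)=0$ for all $n\ge0$. Consequently $S_m(n)\in\mathbb{Q}$ for all $n,m\ge 0$. -/

import Mathlib

open Polynomial

/-- The Yablonskii-Vorob'ev polynomials, as elements of `ℚ[X]`: `Q₀ = 1`, `Q₁ = X` and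
`Qₙ₊₂ = (X Qₙ₊₁² - 4 (Qₙ₊₁ Qₙ₊₁'' - (Qₙ₊₁')²)) / Qₙ`.
The slash is the quotient of polynomial division with remainder; that the remainder always
vanishes is part of the theorem. -/
noncomputable def yablonskiiVorobev : ℕ → ℚ[X]
  | 0 => 1
  | 1 => X
  | n + 2 =>
    (X * yablonskiiVorobev (n + 1) ^ 2
      - 4 * (yablonskiiVorobev (n + 1) * derivative (derivative (yablonskiiVorobev (n + 1)))
        - derivative (yablonskiiVorobev (n + 1)) ^ 2)) / yablonskiiVorobev n

/-- The sum of `1 / z ^ m` over all nonzero complex roots `z` of the `n`-th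
Yablonskii-Vorob'ev polynomial, each repeated according to its multiplicity. -/
noncomputable def inversePowerSum (n m : ℕ) : ℂ :=
  ((((yablonskiiVorobev n).aroots ℂ).filter (fun z : ℂ => z ≠ 0)).map
    (fun z : ℂ => 1 / z ^ m)).sum

/-!
For consecutive `Qₙ, Qₙ₊₁` the logarithmic derivatives `v, u` satisfy the second Painlevé equation
in Hamiltonian form: `w = v - u` solves `w'' = 2 w ^ 3 + z w + (n + 1)` and `2 u` is a polynomial
in `z`, `w`, `w'`. The recurrence acts on such pairs as the Bäcklund transformation raising the
parameter by one.

Exactness of the division comes from Hirota bilinear identities. The equation for a single `v`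
yields a bilinear identity of order four for `Qₙ`, which at a root of multiplicity `m` has leading
term proportional to `m (m - 1)`; hence the roots are simple. For `Qₙ` prime to `Qₙ'` the bilinear
identities of orders two and three for the pair show that `Qₙ` divides the right-hand side.

The power sums are the coefficients of the expansion of `X Qₙ' / Qₙ` at `0`. The recurrence is
homogeneous under `X ↦ ζ X` for `ζ ^ 3 = 1`, so only exponents divisible by `3` occur. The Bäcklund
relation and the equation for a single `v` determine the first two coefficients on each residue
class of `n` modulo `3`. The equation for `v` then yields the others recursively when `Qₙ(0) ≠ 0`;
when `0` is a root, the relation `v' + u' = -(v - u) ^ 2` expresses them through those of `Qₙ₊₁`.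
-/

noncomputable section

open Finset.HasAntidiagonal (antidiagonal)
open scoped Differential PowerSeries
open Differential renaming logDeriv → dlog

/-- The differential ring structure given by a derivation over any base ring. -/
@[reducible]
def differentialOfDerivation {R A : Type*} [CommRing R] [CommRing A] [Algebra R A]
    (d : Derivation R A A) : Differential A :=
  ⟨d.restrictScalars ℤ⟩

section Localization

variable {A : Type*} (B : Type*) [CommRing A] [CommRing B] [Algebra A B] [Differential A]

open KaehlerDifferential in
/-- The extension of the derivation of `A` to a formally étale `A`-algebra `B`: it is read off
from `Ω[B⁄ℤ] ≃ B ⊗[A] Ω[A⁄ℤ]`. -/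
@[reducible]
def differentialOfFormallyEtale [Algebra.FormallyEtale A B] : Differential B :=
  ⟨((((Algebra.linearMap A B).compDer Differential.deriv).liftKaehlerDifferential.liftBaseChange B)
    ∘ₗ (tensorKaehlerEquivOfFormallyEtale ℤ A B).symm.toLinearMap).compDer (D ℤ B)⟩

theorem differentialAlgebra_of_formallyEtale [Algebra.FormallyEtale A B] :
    letI := differentialOfFormallyEtale (A := A) B
    DifferentialAlgebra A B :=
  letI := differentialOfFormallyEtale (A := A) B
  ⟨fun a => by
    simp [Differential.deriv,
      KaehlerDifferential.tensorKaehlerEquivOfFormallyEtale_symm_D_algebraMap]⟩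

instance : Algebra.FormallyEtale A (FractionRing A) :=
  .of_isLocalization (nonZeroDivisors A)

instance : Differential (FractionRing A) :=
  differentialOfFormallyEtale (A := A) _

instance : DifferentialAlgebra A (FractionRing A) :=
  differentialAlgebra_of_formallyEtale _

end Localization

section PolynomialPowerSeries

variable {R S : Type*} [CommRing R] [CommRing S]

instance : Differential R[X] := differentialOfDerivation derivative'

instance : Differential R⟦X⟧ := differentialOfDerivation (PowerSeries.derivative R)

theorem polynomial_deriv_eq (p : R[X]) : p′ = derivative p := rfl

theorem powerSeries_deriv_eq (p : R⟦X⟧) : p′ = PowerSeries.derivative R p := rfl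

instance [Algebra R S] : DifferentialAlgebra R[X] S⟦X⟧ where
  deriv_algebraMap p := by
    rw [PowerSeries.algebraMap_apply', PowerSeries.algebraMap_apply', powerSeries_deriv_eq,
      polynomial_deriv_eq, ← polynomial_map_coe, ← polynomial_map_coe,
      PowerSeries.derivative_coe, derivative_map]

theorem differentialAlgebra_trans (A B C : Type*) [CommRing A] [CommRing B] [CommRing C]
    [Algebra A B] [Algebra B C] [Algebra A C] [IsScalarTower A B C]
    [Differential A] [Differential B] [Differential C]
    [DifferentialAlgebra A B] [DifferentialAlgebra B C] : DifferentialAlgebra A C where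
  deriv_algebraMap a := by
    rw [IsScalarTower.algebraMap_apply A B C, deriv_algebraMap, deriv_algebraMap,
      ← IsScalarTower.algebraMap_apply]

variable {F E : Type*} [Field F] [Field E] [Algebra F E]

instance : FaithfulSMul F[X] E⟦X⟧ := by
  rw [faithfulSMul_iff_algebraMap_injective]
  intro p q h
  rw [PowerSeries.algebraMap_apply', PowerSeries.algebraMap_apply', ← polynomial_map_coe,
    ← polynomial_map_coe] at h
  exact Polynomial.map_injective _ (algebraMap F E).injective (Polynomial.coe_injective E h)

instance : FaithfulSMul F[X] (FractionRing E⟦X⟧) :=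
  FaithfulSMul.trans F[X] E⟦X⟧ _

instance : DifferentialAlgebra F[X] (FractionRing E⟦X⟧) :=
  differentialAlgebra_trans F[X] E⟦X⟧ _

end PolynomialPowerSeries

section DifferentialRing

variable {R : Type*} [CommRing R] [Differential R]

theorem differential_deriv_ofNat (n : ℕ) [n.AtLeastTwo] : (ofNat(n) : R)′ = 0 :=
  Derivation.map_natCast _ n

theorem pow_two_mul_deriv_of_mul_eq {x A U : R} (hx : x′ = 1) (hU : x * U = A) :
    x ^ 2 * U′ = x * A′ - A := by
  subst hU
  simp only [Derivation.leibniz, smul_eq_mul, hx]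
  ring

theorem pow_four_mul_deriv_three_of_mul_eq {x A U : R} (hx : x′ = 1) (hU : x * U = A) :
    x ^ 4 * U′′′ = x ^ 3 * A′′′ - 3 * x ^ 2 * A′′ + 6 * x * A′ - 6 * A := by
  subst hU
  simp only [Derivation.leibniz, map_add, smul_eq_mul, hx, Derivation.map_one_eq_zero,
    map_zero]
  ring

theorem dvd_toda_of_hirota {z α f g : R}
    (hf : IsCoprime f f′) (h₂ : f′′ * g - 2 * f′ * g′ + f * g′′ = 0)
    (h₃ : f′′′ * g - 3 * f′′ * g′ + 3 * f′ * g′′ - f * g′′′ =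
      z * (f′ * g - f * g′) + α * (f * g)) :
    f ∣ z * g ^ 2 - 4 * (g * g′′ - g′ ^ 2) := by
  have h₂' : f′′′ * g - f′′ * g′ - f′ * g′′ + f * g′′′ = 0 := by
    have h := congrArg Differential.deriv h₂
    simp only [map_add, map_sub, map_zero, Derivation.leibniz, smul_eq_mul,
      differential_deriv_ofNat] at h
    linear_combination h
  refine hf.dvd_of_dvd_mul_left
    ⟨2 * g′ * g′′ - 2 * g * g′′′ + z * g * g′ - α * g ^ 2, ?_⟩
  linear_combination g * h₂' - g * h₃ - 2 * g′ * h₂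

end DifferentialRing

section LogDerivative

variable {K : Type*} [Field K] [Differential K] {f g : K}

theorem deriv_eq_dlog_mul (hf : f ≠ 0) : f′ = dlog f * f := by
  rw [dlog, div_mul_cancel₀ _ hf]

theorem deriv_two_eq_dlog_mul (hf : f ≠ 0) : f′′ = ((dlog f)′ + dlog f ^ 2) * f := by
  rw [deriv_eq_dlog_mul hf, Derivation.leibniz, deriv_eq_dlog_mul hf]
  simp only [smul_eq_mul]; ring

theorem deriv_three_eq_dlog_mul (hf : f ≠ 0) :
    f′′′ = ((dlog f)′′ + 3 * dlog f * (dlog f)′ + dlog f ^ 3) * f := by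
  rw [deriv_two_eq_dlog_mul hf, Derivation.leibniz, deriv_eq_dlog_mul hf]
  simp only [map_add, Derivation.leibniz_pow, smul_eq_mul, nsmul_eq_mul]
  push_cast
  ring

theorem deriv_four_eq_dlog_mul (hf : f ≠ 0) :
    f′′′′ = ((dlog f)′′′ + 4 * dlog f * (dlog f)′′ + 3 * (dlog f)′ ^ 2 +
      6 * dlog f ^ 2 * (dlog f)′ + dlog f ^ 4) * f := by
  rw [deriv_three_eq_dlog_mul hf, Derivation.leibniz, deriv_eq_dlog_mul hf]
  simp only [map_add, Derivation.leibniz, Derivation.leibniz_pow, smul_eq_mul, nsmul_eq_mul,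
    differential_deriv_ofNat]
  push_cast
  ring

theorem hirota_two_eq (hf : f ≠ 0) (hg : g ≠ 0) :
    f′′ * g - 2 * f′ * g′ + f * g′′ =
      ((dlog f - dlog g) ^ 2 + (dlog f)′ + (dlog g)′) * (f * g) := by
  rw [deriv_two_eq_dlog_mul hf, deriv_two_eq_dlog_mul hg, deriv_eq_dlog_mul hf,
    deriv_eq_dlog_mul hg]
  ring

theorem hirota_three_eq (hf : f ≠ 0) (hg : g ≠ 0) :
    f′′′ * g - 3 * f′′ * g′ + 3 * f′ * g′′ - f * g′′′ =
      ((dlog f - dlog g)′′ + 3 * (dlog f - dlog g) * ((dlog f)′ + (dlog g)′) +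
        (dlog f - dlog g) ^ 3) * (f * g) := by
  rw [deriv_three_eq_dlog_mul hf, deriv_three_eq_dlog_mul hg, deriv_two_eq_dlog_mul hf,
    deriv_two_eq_dlog_mul hg, deriv_eq_dlog_mul hf, deriv_eq_dlog_mul hg]
  simp only [map_sub]
  ring

theorem hirota_four_self_eq (hf : f ≠ 0) :
    f * f′′′′ - 4 * f′ * f′′′ + 3 * f′′ ^ 2 = ((dlog f)′′′ + 6 * (dlog f)′ ^ 2) * f ^ 2 := by
  rw [deriv_four_eq_dlog_mul hf, deriv_three_eq_dlog_mul hf, deriv_two_eq_dlog_mul hf,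
    deriv_eq_dlog_mul hf]
  ring

theorem hirota_two_self_eq (hf : f ≠ 0) : f * f′′ - f′ ^ 2 = (dlog f)′ * f ^ 2 := by
  rw [deriv_two_eq_dlog_mul hf, deriv_eq_dlog_mul hf]
  ring

end LogDerivative

section PainleveTwo

variable {K : Type*} [Field K] [Differential K] {z : K}

/-- A pair `v, u` of consecutive logarithmic derivatives of tau functions of the second Painlevé
equation with parameter `α`: the difference `w = v - u` solves `w″ = 2 w³ + z w + α`, and `u` is
half of `w′ ^ 2 - w ^ 4 - z w ^ 2 - (2 α + 1) w`, a Hamiltonian of that equation. -/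
structure IsPainlevePair (z α v u : K) : Prop where
  deriv_var : z′ = 1
  deriv_param : α′ = 0
  painleve : (v - u)′′ = 2 * (v - u) ^ 3 + z * (v - u) + α
  hamiltonian : 2 * u = (v - u)′ ^ 2 - (v - u) ^ 4 - z * (v - u) ^ 2 - (2 * α + 1) * (v - u)

namespace IsPainlevePair

variable {α v u f g h : K} (hP : IsPainlevePair z α v u)
include hP

theorem symm : IsPainlevePair z (-α) u v := by
  have p := hP.painleve
  have ham := hP.hamiltonian
  simp only [map_sub] at p ham
  refine ⟨hP.deriv_var, by rw [map_neg, hP.deriv_param, neg_zero], ?_, ?_⟩ <;>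
    simp only [map_sub]
  · linear_combination -p
  · linear_combination ham

theorem two_mul_deriv_right : 2 * u′ = -((v - u) ^ 2 + (v - u)′) := by
  have h := congrArg Differential.deriv hP.hamiltonian
  simp only [map_sub, map_add, Derivation.leibniz, Derivation.leibniz_pow, smul_eq_mul,
    nsmul_eq_mul, differential_deriv_ofNat, hP.deriv_var, hP.deriv_param,
    Derivation.map_one_eq_zero] at h
  have p := hP.painleve
  simp only [map_sub] at p ⊢
  push_cast at h
  linear_combination h + 2 * (v′ - u′) * p

theorem deriv_add_deriv : v′ + u′ = -(v - u) ^ 2 := by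
  have h := hP.two_mul_deriv_right
  rw [map_sub] at h
  linear_combination h

theorem toda_chain [CharZero K] : u′′′ + 6 * u′ ^ 2 = z * u′ + u := by
  have h₁ := hP.two_mul_deriv_right
  have h₂ := congrArg Differential.deriv h₁
  have h₃ := congrArg Differential.deriv h₂
  have p := hP.painleve
  have p' := congrArg Differential.deriv p
  have ham := hP.hamiltonian
  generalize v - u = w at *
  simp only [map_add, map_neg, Derivation.leibniz, Derivation.leibniz_pow, smul_eq_mul,
    nsmul_eq_mul, differential_deriv_ofNat, hP.deriv_var, hP.deriv_param, Derivation.map_natCast,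
    mul_zero, add_zero] at h₂ h₃ p'
  push_cast at h₂ h₃ p'
  linear_combination
    (h₃ - p' - 2 * w * p + 3 * (2 * u′ - w ^ 2 - w′) * h₁ - z * h₁ - ham) / 2

theorem toda_factor_eq : z - 4 * u′ = z + 2 * (v - u) ^ 2 + 2 * (v - u)′ := by
  linear_combination -2 * hP.two_mul_deriv_right

theorem toda_factor_deriv : (z - 4 * u′)′ = 2 * (v - u) * (z - 4 * u′) + (2 * α + 1) := by
  have p := hP.painleve
  rw [hP.toda_factor_eq]
  generalize v - u = w at *
  simp only [map_add, Derivation.leibniz, Derivation.leibniz_pow, smul_eq_mul,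
    nsmul_eq_mul, differential_deriv_ofNat, hP.deriv_var]
  push_cast
  linear_combination 2 * p

theorem toda_factor_mul_sub [CharZero K] {t : K} (hP' : IsPainlevePair z (α + 1) u t) :
    (z - 4 * u′) * (t - v) = 2 * α + 1 := by
  linear_combination (hP.toda_factor_deriv - hP'.symm.toda_factor_deriv) / 2

theorem toda_factor_ne_zero (hα : 2 * α + 1 ≠ 0) : z - 4 * u′ ≠ 0 := by
  intro h0
  have h := hP.toda_factor_deriv
  rw [h0, map_zero] at h
  exact hα (by linear_combination -h)

theorem next (hα : 2 * α + 1 ≠ 0) :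
    IsPainlevePair z (α + 1) u (dlog (z - 4 * u′) + 2 * u - v) := by
  have hφ := hP.toda_factor_ne_zero hα
  have hφ' := hP.toda_factor_deriv
  have hφ_eq := hP.toda_factor_eq
  have h₁ := hP.two_mul_deriv_right
  have p := hP.painleve
  have ham := hP.hamiltonian
  generalize z - 4 * u′ = φ at *
  obtain ⟨w, rfl⟩ : ∃ w, v = u + w := ⟨v - u, by ring⟩
  simp only [add_sub_cancel_left] at *
  obtain ⟨c, hc⟩ : ∃ c, c * φ = 2 * α + 1 := ⟨(2 * α + 1) / φ, div_mul_cancel₀ _ hφ⟩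
  have hdlog : dlog φ = 2 * w + c := by
    rw [dlog, hφ', ← hc, div_eq_iff hφ]
    ring
  have hc' : c′ = -c * (2 * w + c) := by
    have h := congrArg Differential.deriv hc
    simp only [map_add, Derivation.leibniz, smul_eq_mul, differential_deriv_ofNat,
      hP.deriv_param, Derivation.map_one_eq_zero, hφ'] at h
    apply mul_right_cancel₀ hφ
    linear_combination h + c * hc
  have hw : u - (dlog φ + 2 * u - (u + w)) = -(w + c) := by
    rw [hdlog]; ring
  have hw' : (-(w + c))′ = -w′ + 2 * w * c + c ^ 2 := by
    rw [map_neg, map_add, hc']; ring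
  have hw'' : (-(w + c))′′ = - w′′ + 2 * w′ * c - 4 * w ^ 2 * c - 6 * w * c ^ 2 - 2 * c ^ 3 := by
    rw [hw']
    simp only [map_add, map_neg, Derivation.leibniz, Derivation.leibniz_pow, smul_eq_mul,
      nsmul_eq_mul, differential_deriv_ofNat, hc']
    push_cast
    ring
  refine ⟨hP.deriv_var, by simp [hP.deriv_param], ?_, ?_⟩
  · rw [hw, hw'', p]
    linear_combination hc - c * hφ_eq
  · rw [hw, hw', hdlog]
    linear_combination ham + (c + 2 * w) * hc - (c + 2 * w) * c * hφ_eq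

omit hP

theorem hirota_two (hP : IsPainlevePair z α (dlog f) (dlog g)) (hf : f ≠ 0) (hg : g ≠ 0) :
    f′′ * g - 2 * f′ * g′ + f * g′′ = 0 := by
  rw [hirota_two_eq hf hg]
  linear_combination f * g * hP.deriv_add_deriv

theorem hirota_three (hP : IsPainlevePair z α (dlog f) (dlog g)) (hf : f ≠ 0) (hg : g ≠ 0) :
    f′′′ * g - 3 * f′′ * g′ + 3 * f′ * g′′ - f * g′′′ =
      z * (f′ * g - f * g′) + α * (f * g) := by
  rw [hirota_three_eq hf hg, hP.deriv_add_deriv, hP.painleve, deriv_eq_dlog_mul hf,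
    deriv_eq_dlog_mul hg]
  ring

theorem hirota_four [CharZero K] (hP : IsPainlevePair z α v (dlog g)) (hg : g ≠ 0) :
    g * g′′′′ - 4 * g′ * g′′′ + 3 * g′′ ^ 2 = z * (g * g′′ - g′ ^ 2) + g * g′ := by
  rw [hirota_four_self_eq hg, hirota_two_self_eq hg, hP.toda_chain, deriv_eq_dlog_mul hg]
  ring

theorem of_toda (hP : IsPainlevePair z α (dlog f) (dlog g)) (hf : f ≠ 0) (hg : g ≠ 0)
    (hα : 2 * α + 1 ≠ 0) (hrec : h * f = z * g ^ 2 - 4 * (g * g′′ - g′ ^ 2)) :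
    h ≠ 0 ∧ IsPainlevePair z (α + 1) (dlog g) (dlog h) := by
  have hφ := hP.toda_factor_ne_zero hα
  have hmul : h * f = (z - 4 * (dlog g)′) * g ^ 2 := by
    rw [hrec, hirota_two_self_eq hg]
    ring
  have hh : h ≠ 0 := left_ne_zero_of_mul (hmul ▸ mul_ne_zero hφ (pow_ne_zero 2 hg))
  have hdlog : dlog h = dlog (z - 4 * (dlog g)′) + 2 * dlog g - dlog f := by
    have := congrArg dlog hmul
    rw [Differential.logDeriv_mul _ _ hh hf,
      Differential.logDeriv_mul _ _ hφ (pow_ne_zero 2 hg), Differential.logDeriv_pow] at this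
    push_cast at this
    linear_combination this
  exact ⟨hh, hdlog ▸ hP.next hα⟩

end IsPainlevePair

theorem isPainlevePair_zero_dlog (hz : z′ = 1) : IsPainlevePair z 1 0 (dlog z) := by
  have hz₀ : z ≠ 0 := by
    rintro rfl
    exact zero_ne_one ((map_zero _).symm.trans hz)
  have hdlog : dlog z = z⁻¹ := by rw [dlog, hz, one_div]
  have hderiv : (z⁻¹)′ = -z⁻¹ ^ 2 := by
    rw [Derivation.leibniz_inv, hz, smul_eq_mul, mul_one, inv_pow]
  rw [hdlog]
  refine ⟨hz, Derivation.map_one_eq_zero _, ?_, ?_⟩ <;>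
    simp only [zero_sub, map_neg, hderiv, Derivation.leibniz_pow, nsmul_eq_mul, smul_eq_mul]
  · linear_combination mul_inv_cancel₀ hz₀
  · linear_combination z⁻¹ * mul_inv_cancel₀ hz₀

end PainleveTwo

section PowerSumSeries

variable {F : Type*} [Field F]

local notation "ι" => algebraMap F⟦X⟧ (FractionRing F⟦X⟧)

theorem algebraMap_coe_fractionRing (p : F[X]) :
    algebraMap F[X] (FractionRing F⟦X⟧) p = ι p := by
  rw [IsScalarTower.algebraMap_apply F[X] F⟦X⟧, PowerSeries.algebraMap_apply',
    Algebra.algebraMap_self, PowerSeries.map_id, id]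

theorem algebraMap_polynomial_ne_zero {p : F[X]} (hp : p ≠ 0) :
    algebraMap F[X] (FractionRing F⟦X⟧) p ≠ 0 :=
  (map_ne_zero_iff _ (FaithfulSMul.algebraMap_injective _ _)).2 hp

variable [DecidableEq F]

/-- The expansion at `0` of `X p' / p`, where `p` is the monic polynomial with multiset of roots
`s`: its constant coefficient is the multiplicity of the root `0`, and its `m`-th coefficient,
for `m > 0`, is minus the sum of the `m`-th powers of the inverses of the nonzero roots. -/
def powerSumSeries (s : Multiset F) : F⟦X⟧ :=
  PowerSeries.mk fun m =>
    if m = 0 then (s.count 0 : F) else -((s.filter (· ≠ 0)).map fun z => 1 / z ^ m).sum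

theorem powerSumSeries_add (s t : Multiset F) :
    powerSumSeries (s + t) = powerSumSeries s + powerSumSeries t := by
  ext m
  by_cases hm : m = 0 <;> simp [powerSumSeries, hm, add_comm]

theorem X_sub_C_mul_powerSumSeries_singleton (a : F) :
    (PowerSeries.X - PowerSeries.C a) * powerSumSeries {a} = PowerSeries.X := by
  rcases eq_or_ne a 0 with rfl | ha
  · have : powerSumSeries {(0 : F)} = 1 := by
      ext m
      by_cases hm : m = 0 <;>
        simp [powerSumSeries, Multiset.filter_singleton, hm, PowerSeries.coeff_one]
    rw [this, map_zero, sub_zero, mul_one]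
  · have : powerSumSeries {a} = -PowerSeries.X * PowerSeries.invUnitsSub (Units.mk0 a ha) := by
      ext (_ | m) <;>
        simp [powerSumSeries, Multiset.filter_singleton, ha, ha.symm, PowerSeries.coeff_succ_X_mul]
    have h := PowerSeries.invUnitsSub_mul_sub (Units.mk0 a ha)
    rw [Units.val_mk0] at h
    rw [this]
    linear_combination PowerSeries.X * h

theorem X_mul_dlog_X_sub_C (a : F) :
    ι PowerSeries.X * dlog (algebraMap F[X] (FractionRing F⟦X⟧) (X - C a)) =
      ι (powerSumSeries {a}) := by
  rw [dlog, mul_div_assoc', div_eq_iff (algebraMap_polynomial_ne_zero (X_sub_C_ne_zero a)),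
    deriv_algebraMap, polynomial_deriv_eq, derivative_X_sub_C, map_one, mul_one,
    algebraMap_coe_fractionRing, ← map_mul, mul_comm, coe_sub, coe_X, coe_C,
    X_sub_C_mul_powerSumSeries_singleton]

theorem X_mul_dlog_prod_X_sub_C (s : Multiset F) :
    ι PowerSeries.X * dlog (algebraMap F[X] (FractionRing F⟦X⟧) (s.map (X - C ·)).prod) =
      ι (powerSumSeries s) := by
  induction s using Multiset.induction_on with
  | empty =>
    have : powerSumSeries (0 : Multiset F) = 0 := by ext m; simp [powerSumSeries]
    simp [this]
  | cons a s ih =>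
    rw [Multiset.map_cons, Multiset.prod_cons, map_mul, Differential.logDeriv_mul _ _
      (algebraMap_polynomial_ne_zero (X_sub_C_ne_zero a))
      (algebraMap_polynomial_ne_zero (monic_multisetProd_X_sub_C s).ne_zero), mul_add, ih,
      X_mul_dlog_X_sub_C, ← Multiset.singleton_add, powerSumSeries_add, map_add]

theorem X_mul_dlog_of_splits {p : F[X]} (hp : p ≠ 0) (hsplit : p.Splits) :
    ι PowerSeries.X * dlog (algebraMap F[X] (FractionRing F⟦X⟧) p) =
      ι (powerSumSeries p.roots) := by
  conv_lhs => rw [hsplit.eq_prod_roots]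
  rw [map_mul, Differential.logDeriv_mul _ _
    (algebraMap_polynomial_ne_zero (C_ne_zero.2 (leadingCoeff_ne_zero.2 hp)))
    (algebraMap_polynomial_ne_zero (monic_multisetProd_X_sub_C _).ne_zero),
    (Differential.logDeriv_eq_zero _).2, zero_add, X_mul_dlog_prod_X_sub_C]
  rw [deriv_algebraMap, polynomial_deriv_eq, derivative_C, map_zero]

theorem X_mul_dlog_algebraMap {E : Type*} [Field E] [Algebra E F] [IsAlgClosed F]
    {p : E[X]} (hp : p ≠ 0) :
    ι PowerSeries.X * dlog (algebraMap E[X] (FractionRing F⟦X⟧) p) =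
      ι (powerSumSeries (p.aroots F)) := by
  have hmap : algebraMap E[X] (FractionRing F⟦X⟧) p =
      algebraMap F[X] (FractionRing F⟦X⟧) (p.map (algebraMap E F)) := by
    rw [algebraMap_coe_fractionRing, polynomial_map_coe, ← PowerSeries.algebraMap_apply',
      ← IsScalarTower.algebraMap_apply]
  rw [hmap, X_mul_dlog_of_splits (map_ne_zero hp) (IsAlgClosed.splits _), aroots_def]

end PowerSumSeries

section PowerSeriesRelations

variable {F : Type*} [Field F] {A B T : F⟦X⟧} {U V W : FractionRing F⟦X⟧}

local notation "ι" => algebraMap F⟦X⟧ (FractionRing F⟦X⟧)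

theorem deriv_algebraMap_X : (ι PowerSeries.X)′ = 1 := by
  rw [deriv_algebraMap, powerSeries_deriv_eq, PowerSeries.derivative_X, map_one]

theorem toda_chain_of_X_mul_eq {a : F} (hU : ι PowerSeries.X * U = ι A)
    (h : U′′′ + 6 * U′ ^ 2 = ι (PowerSeries.X + PowerSeries.C a) * U′ + U) :
    (PowerSeries.X ^ 3 * A′′′ - 3 * PowerSeries.X ^ 2 * A′′ + 6 * PowerSeries.X * A′ - 6 * A +
      6 * (PowerSeries.X * A′ - A) ^ 2 : F⟦X⟧) =
        PowerSeries.X ^ 4 * A′ +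
          PowerSeries.C a * PowerSeries.X ^ 2 * (PowerSeries.X * A′ - A) := by
  have h₁ := pow_two_mul_deriv_of_mul_eq deriv_algebraMap_X hU
  have h₃ := pow_four_mul_deriv_three_of_mul_eq deriv_algebraMap_X hU
  apply IsFractionRing.injective F⟦X⟧ (FractionRing F⟦X⟧)
  simp only [deriv_algebraMap] at h₁ h₃
  simp only [map_add, map_sub, map_mul, map_pow, map_ofNat] at h ⊢
  generalize ι PowerSeries.X = x at *
  linear_combination x ^ 4 * h - h₃ + x ^ 3 * hU + (x ^ 3 + ι (PowerSeries.C a) * x ^ 2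
    - 6 * (x ^ 2 * U′ + x * ι A′ - ι A)) * h₁

theorem deriv_add_deriv_of_X_mul_eq (hU : ι PowerSeries.X * U = ι A)
    (hV : ι PowerSeries.X * V = ι B) (h : U′ + V′ = -(U - V) ^ 2) :
    (PowerSeries.X * A′ - A) + (PowerSeries.X * B′ - B) = -(A - B) ^ 2 := by
  have hU' := pow_two_mul_deriv_of_mul_eq deriv_algebraMap_X hU
  have hV' := pow_two_mul_deriv_of_mul_eq deriv_algebraMap_X hV
  apply IsFractionRing.injective F⟦X⟧ (FractionRing F⟦X⟧)
  simp only [map_add, map_sub, map_mul, map_pow, map_neg, ← deriv_algebraMap]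
  rw [← hU', ← hV', ← hU, ← hV]
  linear_combination ι PowerSeries.X ^ 2 * h

theorem toda_factor_mul_sub_of_X_mul_eq {c : F⟦X⟧} (hU : ι PowerSeries.X * U = ι A)
    (hV : ι PowerSeries.X * V = ι B) (hW : ι PowerSeries.X * W = ι T)
    (h : (ι PowerSeries.X - 4 * V′) * (W - U) = ι c) :
    (PowerSeries.X ^ 3 - 4 * (PowerSeries.X * B′ - B)) * (T - A) = c * PowerSeries.X ^ 3 := by
  have hV' := pow_two_mul_deriv_of_mul_eq deriv_algebraMap_X hV
  apply IsFractionRing.injective F⟦X⟧ (FractionRing F⟦X⟧)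
  simp only [map_sub, map_mul, map_pow, map_ofNat, ← deriv_algebraMap]
  rw [← hV', ← hU, ← hW]
  linear_combination ι PowerSeries.X ^ 3 * h

end PowerSeriesRelations

section Separable

variable {F : Type*} [Field F]

local notation "ι" => algebraMap F⟦X⟧ (FractionRing F⟦X⟧)

theorem rootMultiplicity_zero_le_one_of_hirota [IsAlgClosed F] [CharZero F] {p : F[X]}
    (hp : p ≠ 0) (a : F)
    (h : p * p′′′′ - 4 * p′ * p′′′ + 3 * p′′ ^ 2 = (X + C a) * (p * p′′ - p′ ^ 2) + p * p′) :
    p.rootMultiplicity 0 ≤ 1 := by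
  classical
  have hU := X_mul_dlog_of_splits hp (IsAlgClosed.splits p)
  have hpK := algebraMap_polynomial_ne_zero hp
  have hvar : algebraMap F[X] (FractionRing F⟦X⟧) (X + C a) =
      ι (PowerSeries.X + PowerSeries.C a) := by
    rw [algebraMap_coe_fractionRing, coe_add, coe_X, coe_C]
  have hK := congrArg (algebraMap F[X] (FractionRing F⟦X⟧)) h
  simp only [map_add, map_sub, map_mul, map_pow, map_ofNat, ← deriv_algebraMap] at hK
  rw [hirota_four_self_eq hpK, hirota_two_self_eq hpK, deriv_eq_dlog_mul hpK] at hK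
  have hchain := toda_chain_of_X_mul_eq (a := a) hU (mul_right_cancel₀ (pow_ne_zero 2 hpK) (by
    rw [hK, ← hvar, map_add]
    ring))
  have h₀ : ((p.rootMultiplicity 0 : ℕ) : F) * (p.rootMultiplicity 0 - 1 : F) = 0 := by
    have h := congrArg PowerSeries.constantCoeff hchain
    replace h : -(6 * (p.rootMultiplicity 0 : F)) + 6 * (p.rootMultiplicity 0 : F) ^ 2 = 0 := by
      simpa [powerSumSeries, count_roots, map_ofNat PowerSeries.constantCoeff 6] using h
    linear_combination h / 6
  rcases mul_eq_zero.1 h₀ with h₀ | h₀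
  · exact (Nat.cast_eq_zero.1 h₀).trans_le zero_le_one
  · exact (Nat.cast_eq_one.1 (sub_eq_zero.1 h₀)).le

theorem separable_of_hirota [CharZero F] {p : F[X]} (hp : p ≠ 0)
    (h : p * p′′′′ - 4 * p′ * p′′′ + 3 * p′′ ^ 2 = X * (p * p′′ - p′ ^ 2) + p * p′) :
    p.Separable := by
  classical
  set i := algebraMap F (AlgebraicClosure F)
  have hp' : p.map i ≠ 0 := map_ne_zero hp
  rw [← separable_map i, ← nodup_roots_iff_of_splits hp' (IsAlgClosed.splits _),
    Multiset.nodup_iff_count_le_one]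
  intro a
  rw [count_roots, rootMultiplicity_eq_rootMultiplicity]
  refine rootMultiplicity_zero_le_one_of_hirota (comp_X_add_C_ne_zero_iff.2 hp') a ?_
  have hcomp := congrArg (fun q : F[X] => (q.map i).comp (X + C a)) h
  have hderiv (q : F[X]) : ((q.map i).comp (X + C a))′ = ((q′).map i).comp (X + C a) := by
    simp [polynomial_deriv_eq, derivative_comp, derivative_map]
  simpa [hderiv] using hcomp

end Separable

section PolynomialTau

variable {F K : Type*} [Field F] [Field K] [Differential K] [Algebra F[X] K]
  [DifferentialAlgebra F[X] K] [FaithfulSMul F[X] K]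

theorem separable_left_of_isPainlevePair [CharZero F] {f : F[X]} {α u : K} (hf : f ≠ 0)
    (hP : IsPainlevePair (algebraMap F[X] K X) α (dlog (algebraMap F[X] K f)) u) :
    f.Separable := by
  have hinj := FaithfulSMul.algebraMap_injective F[X] K
  have : CharZero K := charZero_of_injective_algebraMap hinj
  refine separable_of_hirota hf (hinj ?_)
  simpa only [map_add, map_sub, map_mul, map_pow, map_ofNat, deriv_algebraMap]
    using hP.symm.hirota_four ((FaithfulSMul.algebraMap_eq_zero_iff F[X] K).not.2 hf)

theorem dvd_toda_of_isPainlevePair {f g α : F[X]} (hf : f.Separable) (hg : g ≠ 0)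
    (hP : IsPainlevePair (algebraMap F[X] K X) (algebraMap F[X] K α)
      (dlog (algebraMap F[X] K f)) (dlog (algebraMap F[X] K g))) :
    f ∣ X * g ^ 2 - 4 * (g * g′′ - g′ ^ 2) := by
  have hfK := (FaithfulSMul.algebraMap_eq_zero_iff F[X] K).not.2 hf.ne_zero
  have hgK := (FaithfulSMul.algebraMap_eq_zero_iff F[X] K).not.2 hg
  refine dvd_toda_of_hirota (α := α) hf (FaithfulSMul.algebraMap_injective F[X] K ?_)
    (FaithfulSMul.algebraMap_injective F[X] K ?_)
  · simpa only [map_add, map_sub, map_mul, map_pow, map_ofNat, map_zero, deriv_algebraMap]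
      using hP.hirota_two hfK hgK
  · simpa only [map_add, map_sub, map_mul, map_pow, map_ofNat, map_zero, deriv_algebraMap]
      using hP.hirota_three hfK hgK

end PolynomialTau

section YablonskiiVorobev

local notation "Q" => yablonskiiVorobev

variable (K : Type*) [Field K] [Differential K] [Algebra ℚ[X] K]
  [DifferentialAlgebra ℚ[X] K] [FaithfulSMul ℚ[X] K]

theorem yablonskiiVorobev_add_two_mul_of_isPainlevePair {n : ℕ} (hn : Q n ≠ 0)
    (hsucc : Q (n + 1) ≠ 0)
    (hP : IsPainlevePair (algebraMap ℚ[X] K X) (n + 1) (dlog (algebraMap ℚ[X] K (Q n)))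
      (dlog (algebraMap ℚ[X] K (Q (n + 1))))) :
    Q (n + 2) * Q n = X * Q (n + 1) ^ 2 - 4 * (Q (n + 1) * (Q (n + 1))′′ - (Q (n + 1))′ ^ 2) := by
  have hdvd : Q n ∣ X * Q (n + 1) ^ 2 - 4 * (Q (n + 1) * (Q (n + 1))′′ - (Q (n + 1))′ ^ 2) :=
    dvd_toda_of_isPainlevePair (K := K) (α := n + 1) (separable_left_of_isPainlevePair hn hP)
      hsucc (by simpa using hP)
  rw [mul_comm]
  exact EuclideanDomain.mul_div_cancel' hn hdvd

theorem yablonskiiVorobev_ne_zero_and_isPainlevePair (n : ℕ) : Q n ≠ 0 ∧ Q (n + 1) ≠ 0 ∧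
    IsPainlevePair (algebraMap ℚ[X] K X) (n + 1) (dlog (algebraMap ℚ[X] K (Q n)))
      (dlog (algebraMap ℚ[X] K (Q (n + 1)))) := by
  induction n with
  | zero =>
    refine ⟨one_ne_zero, X_ne_zero, ?_⟩
    have h := isPainlevePair_zero_dlog (z := algebraMap ℚ[X] K X)
      (by rw [deriv_algebraMap, polynomial_deriv_eq, derivative_X, map_one])
    simpa [yablonskiiVorobev] using h
  | succ n ih =>
    obtain ⟨hn, hsucc, hP⟩ := ih
    have hrec := congrArg (algebraMap ℚ[X] K)
      (yablonskiiVorobev_add_two_mul_of_isPainlevePair K hn hsucc hP)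
    simp only [map_mul, map_sub, map_pow, map_ofNat, ← deriv_algebraMap] at hrec
    have : CharZero K :=
      charZero_of_injective_algebraMap (FaithfulSMul.algebraMap_injective ℚ[X] K)
    have hα : (2 * (n + 1) + 1 : K) ≠ 0 := mod_cast Nat.succ_ne_zero (2 * (n + 1))
    have hne {p : ℚ[X]} : algebraMap ℚ[X] K p ≠ 0 ↔ p ≠ 0 :=
      (FaithfulSMul.algebraMap_eq_zero_iff ℚ[X] K).not
    obtain ⟨hsucc', hP'⟩ := hP.of_toda (hne.2 hn) (hne.2 hsucc) hα hrec
    exact ⟨hsucc, hne.1 hsucc', by exact_mod_cast hP'⟩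

end YablonskiiVorobev

section Coefficients

variable {R : Type*} [CommRing R]

theorem coeff_X_mul_deriv (A : R⟦X⟧) (m : ℕ) :
    PowerSeries.coeff m (PowerSeries.X * A′) = m * PowerSeries.coeff m A := by
  cases m with
  | zero => simp
  | succ m =>
    rw [PowerSeries.coeff_succ_X_mul, powerSeries_deriv_eq, PowerSeries.coeff_derivative,
      Nat.cast_succ, mul_comm]

theorem coeff_X_mul_deriv_sub (A : R⟦X⟧) (m : ℕ) :
    PowerSeries.coeff m (PowerSeries.X * A′ - A) = (m - 1) * PowerSeries.coeff m A := by
  rw [map_sub, coeff_X_mul_deriv]; ring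

theorem coeff_euler_cubic (A : R⟦X⟧) (m : ℕ) :
    PowerSeries.coeff m (PowerSeries.X ^ 3 * A′′′ - 3 * PowerSeries.X ^ 2 * A′′ +
      6 * PowerSeries.X * A′ - 6 * A) = (m - 1) * (m - 2) * (m - 3) * PowerSeries.coeff m A := by
  have hX : (PowerSeries.X : R⟦X⟧)′ = 1 := PowerSeries.derivative_X
  have hsub (c : ℕ) (B : R⟦X⟧) : PowerSeries.coeff m (PowerSeries.X * B′ - (c : R⟦X⟧) * B) =
      (m - c) * PowerSeries.coeff m B := by
    rw [map_sub, coeff_X_mul_deriv, ← nsmul_eq_mul (n := c), map_nsmul, nsmul_eq_mul, sub_mul]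
  -- With `θ = X d/dX`, the operator on the left is `(θ - 1) (θ - 2) (θ - 3)`.
  set B := PowerSeries.X * A′ - ((1 : ℕ) : R⟦X⟧) * A with hB
  set C := PowerSeries.X * B′ - ((2 : ℕ) : R⟦X⟧) * B with hC
  have : PowerSeries.X ^ 3 * A′′′ - 3 * PowerSeries.X ^ 2 * A′′ + 6 * PowerSeries.X * A′ - 6 * A =
      PowerSeries.X * C′ - ((3 : ℕ) : R⟦X⟧) * C := by
    simp only [hC, hB, map_sub, map_add, Derivation.leibniz, smul_eq_mul, hX,
      Derivation.map_natCast, Derivation.map_one_eq_zero, map_zero]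
    push_cast
    ring
  rw [this, hsub, hC, hsub, hB, hsub]
  push_cast
  ring

theorem X_mul_deriv_rescale (c : R) (A : R⟦X⟧) :
    PowerSeries.X * (PowerSeries.rescale c A)′ = PowerSeries.rescale c (PowerSeries.X * A′) := by
  ext m
  simp only [coeff_X_mul_deriv, PowerSeries.coeff_rescale]
  ring

theorem rescale_eq_self_of_mul [IsDomain R] {A B D : R⟦X⟧} {c : R} (hA : A ≠ 0)
    (hA' : PowerSeries.rescale c A = A) (hD : PowerSeries.rescale c D = D) (h : A * B = D) :
    PowerSeries.rescale c B = B := by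
  apply mul_left_cancel₀ hA
  conv_lhs => rw [← hA']
  rw [← map_mul, h, hD]

theorem coeff_mul_of_dvd_support {S : Type*} [Semiring S] {d : ℕ} (hd : d ≠ 0) {A : S⟦X⟧}
    (hA : ∀ m, ¬ d ∣ m → PowerSeries.coeff m A = 0) (B : S⟦X⟧) (k : ℕ) :
    PowerSeries.coeff (d * k) (A * B) = ∑ ij ∈ antidiagonal k,
      PowerSeries.coeff (d * ij.1) A * PowerSeries.coeff (d * ij.2) B := by
  rw [PowerSeries.coeff_mul]
  symm
  refine Finset.sum_of_injOn (fun ij => (d * ij.1, d * ij.2)) ?_ ?_ ?_ fun _ _ => rfl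
  · rintro ⟨i, j⟩ - ⟨i', j'⟩ - h
    simpa [hd] using h
  · rintro ⟨i, j⟩ h
    simpa [← mul_add, hd] using h
  · rintro ⟨i, j⟩ h hij
    rw [hA i, zero_mul]
    rintro ⟨i, rfl⟩
    obtain ⟨j, rfl⟩ := (Nat.dvd_add_right (dvd_mul_right d i)).1
      ((Finset.HasAntidiagonal.mem_antidiagonal.1 h).symm ▸ dvd_mul_right d k)
    exact hij ⟨(i, j), by simpa [← mul_add, hd] using h, rfl⟩

end Coefficients

section RootSeries

local notation "Q" => yablonskiiVorobev
local notation "𝕂" => FractionRing ℂ⟦X⟧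

open Classical in
/-- The generating series of the inverse power sums of the roots of the `n`-th Yablonskii-Vorob'ev
polynomial `Qₙ`, that is, the expansion of `X Qₙ' / Qₙ` at `0`. -/
def rootSeries (n : ℕ) : ℂ⟦X⟧ := powerSumSeries ((Q n).aroots ℂ)

theorem rootSeries_zero : rootSeries 0 = 0 := by
  ext m
  simp [rootSeries, yablonskiiVorobev, powerSumSeries]

theorem rootSeries_one : rootSeries 1 = 1 := by
  ext m
  simp [rootSeries, yablonskiiVorobev, powerSumSeries, PowerSeries.coeff_one,
    Multiset.filter_singleton]

theorem inversePowerSum_eq_neg_coeff {n m : ℕ} (hm : m ≠ 0) :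
    inversePowerSum n m = - PowerSeries.coeff m (rootSeries n) := by
  simp [rootSeries, inversePowerSum, powerSumSeries, hm]

local instance : CharZero 𝕂 := algebraRat.charZero _

theorem yablonskiiVorobev_ne_zero (n : ℕ) : Q n ≠ 0 :=
  (yablonskiiVorobev_ne_zero_and_isPainlevePair 𝕂 n).1

theorem yablonskiiVorobev_add_two_mul (n : ℕ) :
    Q (n + 2) * Q n = X * Q (n + 1) ^ 2 -
      4 * (Q (n + 1) * derivative (derivative (Q (n + 1))) - derivative (Q (n + 1)) ^ 2) :=
  have ⟨hn, hsucc, hP⟩ := yablonskiiVorobev_ne_zero_and_isPainlevePair 𝕂 n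
  yablonskiiVorobev_add_two_mul_of_isPainlevePair 𝕂 hn hsucc hP

/-- The logarithmic derivative of the `n`-th Yablonskii-Vorob'ev polynomial, as a formal Laurent
series over `ℂ`. -/
def logDerivYablonskiiVorobev (n : ℕ) : 𝕂 := dlog (algebraMap ℚ[X] 𝕂 (Q n))

theorem X_mul_logDerivYablonskiiVorobev (n : ℕ) :
    algebraMap ℂ⟦X⟧ 𝕂 PowerSeries.X * logDerivYablonskiiVorobev n =
      algebraMap ℂ⟦X⟧ 𝕂 (rootSeries n) :=
  X_mul_dlog_algebraMap (yablonskiiVorobev_ne_zero n)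

theorem isPainlevePair_logDerivYablonskiiVorobev (n : ℕ) :
    IsPainlevePair (algebraMap ℂ⟦X⟧ 𝕂 PowerSeries.X) (n + 1) (logDerivYablonskiiVorobev n)
      (logDerivYablonskiiVorobev (n + 1)) := by
  have hX : algebraMap ℂ⟦X⟧ 𝕂 PowerSeries.X = algebraMap ℚ[X] 𝕂 X := by
    rw [IsScalarTower.algebraMap_apply ℚ[X] ℂ⟦X⟧ 𝕂, PowerSeries.algebraMap_apply', coe_X,
      PowerSeries.map_X]
  exact hX ▸ (yablonskiiVorobev_ne_zero_and_isPainlevePair 𝕂 n).2.2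

theorem rootSeries_toda_chain (n : ℕ) :
    (PowerSeries.X ^ 3 * (rootSeries n)′′′ - 3 * PowerSeries.X ^ 2 * (rootSeries n)′′ +
        6 * PowerSeries.X * (rootSeries n)′ - 6 * rootSeries n) +
      6 * (PowerSeries.X * (rootSeries n)′ - rootSeries n) ^ 2 =
        PowerSeries.X ^ 3 * (PowerSeries.X * (rootSeries n)′) := by
  have h := toda_chain_of_X_mul_eq (a := 0) (X_mul_logDerivYablonskiiVorobev n)
    (by simpa using (isPainlevePair_logDerivYablonskiiVorobev n).symm.toda_chain)
  rw [map_zero, zero_mul, zero_mul, add_zero] at h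
  rw [h, pow_succ, mul_assoc]

theorem rootSeries_miura (n : ℕ) :
    (PowerSeries.X * (rootSeries n)′ - rootSeries n) +
        (PowerSeries.X * (rootSeries (n + 1))′ - rootSeries (n + 1)) =
      -(rootSeries n - rootSeries (n + 1)) ^ 2 :=
  deriv_add_deriv_of_X_mul_eq (X_mul_logDerivYablonskiiVorobev n)
    (X_mul_logDerivYablonskiiVorobev (n + 1))
    (isPainlevePair_logDerivYablonskiiVorobev n).deriv_add_deriv

theorem rootSeries_backlund (n : ℕ) :
    (PowerSeries.X ^ 3 - 4 * (PowerSeries.X * (rootSeries (n + 1))′ - rootSeries (n + 1))) *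
      (rootSeries (n + 2) - rootSeries n) = PowerSeries.C (2 * n + 3 : ℂ) * PowerSeries.X ^ 3 := by
  refine toda_factor_mul_sub_of_X_mul_eq (X_mul_logDerivYablonskiiVorobev n)
    (X_mul_logDerivYablonskiiVorobev (n + 1)) (X_mul_logDerivYablonskiiVorobev (n + 2)) ?_
  rw [(isPainlevePair_logDerivYablonskiiVorobev n).toda_factor_mul_sub
    (by exact_mod_cast isPainlevePair_logDerivYablonskiiVorobev (n + 1))]
  simp only [map_add, map_mul, map_ofNat, map_natCast]
  ring

theorem rescale_rootSeries {ζ : ℂ} (hζ : ζ ^ 3 = 1) (n : ℕ) :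
    PowerSeries.rescale ζ (rootSeries n) = rootSeries n := by
  have hX : PowerSeries.rescale ζ ((PowerSeries.X : ℂ⟦X⟧) ^ 3) = PowerSeries.X ^ 3 := by
    rw [map_pow, PowerSeries.rescale_X, mul_pow, ← map_pow, hζ, map_one, one_mul]
  induction n using Nat.twoStepInduction with
  | zero => rw [rootSeries_zero, map_zero]
  | one => rw [rootSeries_one, map_one]
  | more n hn hsucc =>
    have h := rootSeries_backlund n
    have hne : PowerSeries.C (2 * n + 3 : ℂ) * PowerSeries.X ^ 3 ≠ 0 :=
      mul_ne_zero ((map_ne_zero_iff _ PowerSeries.C_injective).2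
        (by exact_mod_cast Nat.succ_ne_zero (2 * n + 2))) (pow_ne_zero 3 PowerSeries.X_ne_zero)
    have hsub := rescale_eq_self_of_mul (c := ζ) (left_ne_zero_of_mul (h ▸ hne))
      (by rw [map_sub, map_mul, map_sub, ← X_mul_deriv_rescale, hX, hsucc, map_ofNat])
      (by simp only [map_add, map_mul, map_ofNat, map_natCast, hX]) h
    rw [map_sub, hn] at hsub
    exact sub_left_injective hsub

theorem coeff_rootSeries_eq_zero {m : ℕ} (hm : ¬ 3 ∣ m) (n : ℕ) :
    PowerSeries.coeff m (rootSeries n) = 0 := by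
  have hζ := Complex.isPrimitiveRoot_exp 3 three_ne_zero
  have h := congrArg (PowerSeries.coeff m) (rescale_rootSeries hζ.pow_eq_one n)
  rw [PowerSeries.coeff_rescale] at h
  by_contra h₀
  exact hm ((hζ.pow_eq_one_iff_dvd m).1 (mul_eq_right₀ h₀ |>.1 h))

end RootSeries

/-- The coefficient of `X ^ (3 * k)` in `rootSeries n`; no other exponents occur. -/
def rootCoeff (n k : ℕ) : ℂ := PowerSeries.coeff (3 * k) (rootSeries n)

theorem rootCoeff_toda_chain (n k : ℕ) :
    (3 * k + 2) * (3 * k + 1) * (3 * k) * rootCoeff n (k + 1) +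
      6 * ∑ ij ∈ antidiagonal (k + 1),
        (3 * ij.1 - 1) * rootCoeff n ij.1 * ((3 * ij.2 - 1) * rootCoeff n ij.2) =
    3 * k * rootCoeff n k := by
  have h := congrArg (PowerSeries.coeff (3 * (k + 1))) (rootSeries_toda_chain n)
  rw [map_add, coeff_euler_cubic, ← map_ofNat PowerSeries.C, PowerSeries.coeff_C_mul, sq,
    coeff_mul_of_dvd_support three_ne_zero, mul_add_one, PowerSeries.coeff_X_pow_mul,
    coeff_X_mul_deriv] at h
  · simp only [coeff_X_mul_deriv_sub] at h
    push_cast at h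
    simp only [rootCoeff, mul_add_one]
    linear_combination h
  · intro m hm
    rw [coeff_X_mul_deriv_sub, coeff_rootSeries_eq_zero hm, mul_zero]

theorem rootCoeff_add_rootCoeff (n k : ℕ) :
    (3 * k - 1) * (rootCoeff n k + rootCoeff (n + 1) k) =
      -∑ ij ∈ antidiagonal k, (rootCoeff n ij.1 - rootCoeff (n + 1) ij.1) *
        (rootCoeff n ij.2 - rootCoeff (n + 1) ij.2) := by
  have h := congrArg (PowerSeries.coeff (3 * k)) (rootSeries_miura n)
  rw [map_add, coeff_X_mul_deriv_sub, coeff_X_mul_deriv_sub, map_neg, sq,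
    coeff_mul_of_dvd_support three_ne_zero] at h
  · simp only [map_sub] at h
    push_cast at h
    simp only [rootCoeff]
    linear_combination h
  · intro m hm
    rw [map_sub, coeff_rootSeries_eq_zero hm, coeff_rootSeries_eq_zero hm, sub_zero]

theorem rootCoeff_backlund (n k : ℕ) :
    ∑ ij ∈ antidiagonal k,
      ((if ij.1 = 1 then 1 else 0) - 4 * ((3 * ij.1 - 1) * rootCoeff (n + 1) ij.1)) *
        (rootCoeff (n + 2) ij.2 - rootCoeff n ij.2) = if k = 1 then 2 * (n : ℂ) + 3 else 0 := by
  have hthree (i : ℕ) : 3 * i = 3 ↔ i = 1 := by omega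
  have h := congrArg (PowerSeries.coeff (3 * k)) (rootSeries_backlund n)
  rw [coeff_mul_of_dvd_support three_ne_zero, PowerSeries.coeff_C_mul, PowerSeries.coeff_X_pow,
    mul_ite, mul_one, mul_zero] at h
  · simp only [map_sub, ← map_ofNat PowerSeries.C, PowerSeries.coeff_C_mul,
      coeff_X_mul_deriv, PowerSeries.coeff_X_pow, hthree] at h
    rw [← h]
    refine Finset.sum_congr rfl fun ij _ => ?_
    simp only [rootCoeff]
    push_cast
    ring
  · intro m hm
    rw [map_sub, PowerSeries.coeff_X_pow, if_neg (by rintro rfl; exact hm dvd_rfl),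
      ← map_ofNat PowerSeries.C, PowerSeries.coeff_C_mul, coeff_X_mul_deriv_sub,
      coeff_rootSeries_eq_zero hm]
    ring

theorem rootCoeff_zero_mul_rootCoeff_one (n : ℕ) : rootCoeff n 0 * rootCoeff n 1 = 0 := by
  have h := rootCoeff_toda_chain n 0
  simp only [Finset.Nat.sum_antidiagonal_eq_sum_range_succ_mk, Finset.sum_range_succ,
    Finset.sum_range_zero, Nat.reduceAdd, Nat.reduceSub, tsub_zero, Nat.cast_zero,
    Nat.cast_one] at h
  linear_combination -h / 24

theorem rootCoeff_two_eq (n : ℕ) :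
    20 * (1 - rootCoeff n 0) * rootCoeff n 2 = rootCoeff n 1 - 8 * rootCoeff n 1 ^ 2 := by
  have h := rootCoeff_toda_chain n 1
  simp only [Finset.Nat.sum_antidiagonal_eq_sum_range_succ_mk, Finset.sum_range_succ,
    Finset.sum_range_zero, Nat.reduceAdd, Nat.reduceSub, tsub_zero, Nat.cast_zero, Nat.cast_one,
    Nat.cast_ofNat] at h
  linear_combination h / 3

theorem rootCoeff_three_eq (n : ℕ) :
    (56 - 16 * rootCoeff n 0) * rootCoeff n 3 =
      rootCoeff n 2 - 20 * rootCoeff n 1 * rootCoeff n 2 := by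
  have h := rootCoeff_toda_chain n 2
  simp only [Finset.Nat.sum_antidiagonal_eq_sum_range_succ_mk, Finset.sum_range_succ,
    Finset.sum_range_zero, Nat.reduceAdd, Nat.reduceSub, tsub_zero, Nat.cast_zero, Nat.cast_one,
    Nat.cast_ofNat] at h
  linear_combination h / 6

theorem rootCoeff_backlund_zero (n : ℕ) :
    rootCoeff (n + 1) 0 * (rootCoeff (n + 2) 0 - rootCoeff n 0) = 0 := by
  have h := rootCoeff_backlund n 0
  simp only [Finset.Nat.antidiagonal_zero, Finset.sum_singleton, zero_ne_one, if_false,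
    Nat.cast_zero] at h
  linear_combination h / 4

theorem rootCoeff_backlund_one (n : ℕ) :
    4 * rootCoeff (n + 1) 0 * (rootCoeff (n + 2) 1 - rootCoeff n 1) +
      (1 - 8 * rootCoeff (n + 1) 1) * (rootCoeff (n + 2) 0 - rootCoeff n 0) = 2 * n + 3 := by
  have h := rootCoeff_backlund n 1
  simp only [Finset.Nat.sum_antidiagonal_eq_sum_range_succ_mk, Finset.sum_range_succ,
    Finset.sum_range_zero, Nat.reduceSub, tsub_zero, zero_ne_one, if_false, if_true,
    Nat.cast_zero, Nat.cast_one] at h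
  linear_combination h

theorem rootCoeff_backlund_two (n : ℕ) :
    4 * rootCoeff (n + 1) 0 * (rootCoeff (n + 2) 2 - rootCoeff n 2) +
      (1 - 8 * rootCoeff (n + 1) 1) * (rootCoeff (n + 2) 1 - rootCoeff n 1) =
      20 * rootCoeff (n + 1) 2 * (rootCoeff (n + 2) 0 - rootCoeff n 0) := by
  have h := rootCoeff_backlund n 2
  simp only [Finset.Nat.sum_antidiagonal_eq_sum_range_succ_mk, Finset.sum_range_succ,
    Finset.sum_range_zero, Nat.reduceSub, tsub_zero, zero_ne_one, OfNat.ofNat_ne_one, if_false,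
    if_true, Nat.cast_zero, Nat.cast_one, Nat.cast_ofNat] at h
  linear_combination h

theorem rootCoeff_zero (k : ℕ) : rootCoeff 0 k = 0 := by
  rw [rootCoeff, rootSeries_zero, map_zero]

theorem rootCoeff_one_zero : rootCoeff 1 0 = 1 := by
  rw [rootCoeff, rootSeries_one, mul_zero, PowerSeries.coeff_zero_one]

theorem rootCoeff_add_two_of_zero_of_one {n : ℕ} (h₀ : rootCoeff n 0 = 0)
    (h₁ : rootCoeff n 1 = -n / 4) (hsucc : rootCoeff (n + 1) 0 = 1) :
    rootCoeff (n + 2) 0 = 0 ∧ rootCoeff (n + 2) 1 = (n + 3) / 4 := by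
  have h₀' := rootCoeff_backlund_zero n
  have h₁' := rootCoeff_backlund_one n
  have hmul := rootCoeff_zero_mul_rootCoeff_one (n + 1)
  rw [hsucc, one_mul] at hmul
  rw [hsucc, h₀, one_mul, sub_zero] at h₀'
  rw [hsucc, h₀, h₁, h₀', hmul] at h₁'
  exact ⟨h₀', by linear_combination h₁' / 4⟩

theorem rootCoeff_add_two_of_one_of_zero {n : ℕ} (h₀ : rootCoeff n 0 = 1)
    (hsucc₀ : rootCoeff (n + 1) 0 = 0) (hsucc₁ : rootCoeff (n + 1) 1 = (n + 2) / 4) :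
    rootCoeff (n + 2) 0 = 0 ∧ rootCoeff (n + 2) 1 = -(n + 2) / 4 := by
  have hn : (2 * n + 3 : ℂ) ≠ 0 := mod_cast Nat.succ_ne_zero (2 * n + 2)
  have h₀' := rootCoeff_backlund_one n
  have h₁' := rootCoeff_backlund_two n
  have hsucc₂ := rootCoeff_two_eq (n + 1)
  have h₁ := rootCoeff_zero_mul_rootCoeff_one n
  rw [h₀, one_mul] at h₁
  rw [hsucc₀, hsucc₁] at h₀' h₁' hsucc₂
  rw [h₀] at h₀' h₁'
  rw [h₁] at h₁'
  have hz : rootCoeff (n + 2) 0 = 0 := by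
    apply mul_left_cancel₀ hn
    linear_combination -h₀'
  refine ⟨hz, mul_left_cancel₀ hn ?_⟩
  rw [hz] at h₁'
  linear_combination -h₁' + hsucc₂

theorem rootCoeff_add_two_of_zero_of_zero {n : ℕ} (h₀ : rootCoeff n 0 = 0)
    (hsucc₀ : rootCoeff (n + 1) 0 = 0) (hsucc₁ : rootCoeff (n + 1) 1 = -(n + 1) / 4) :
    rootCoeff (n + 2) 0 = 1 := by
  have h := rootCoeff_backlund_one n
  rw [h₀, hsucc₀, hsucc₁] at h
  have hn : (2 * n + 3 : ℂ) ≠ 0 := mod_cast Nat.succ_ne_zero (2 * n + 2)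
  apply mul_left_cancel₀ hn
  linear_combination h

theorem rootCoeff_three_mul_add (k : ℕ) :
    (rootCoeff (3 * k) 0 = 0 ∧ rootCoeff (3 * k) 1 = -(3 * k : ℕ) / 4) ∧
      rootCoeff (3 * k + 1) 0 = 1 ∧
      rootCoeff (3 * k + 2) 0 = 0 ∧ rootCoeff (3 * k + 2) 1 = ((3 * k : ℕ) + 3) / 4 := by
  suffices h : rootCoeff (3 * k) 0 = 0 ∧ rootCoeff (3 * k) 1 = -(3 * k : ℕ) / 4 ∧
      rootCoeff (3 * k + 1) 0 = 1 from
    ⟨⟨h.1, h.2.1⟩, h.2.2, rootCoeff_add_two_of_zero_of_one h.1 h.2.1 h.2.2⟩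
  induction k with
  | zero => simp [rootCoeff_zero, rootCoeff_one_zero]
  | succ k ih =>
    obtain ⟨h₀, h₁, hsucc⟩ := ih
    obtain ⟨htwo₀, htwo₁⟩ := rootCoeff_add_two_of_zero_of_one h₀ h₁ hsucc
    obtain ⟨hthree₀, hthree₁⟩ := rootCoeff_add_two_of_one_of_zero hsucc htwo₀
      (by rw [htwo₁]; push_cast; ring)
    refine ⟨hthree₀, ?_,
      rootCoeff_add_two_of_zero_of_zero (n := 3 * k + 2) htwo₀ hthree₀ (hthree₁.trans ?_)⟩
    · rw [mul_add_one, hthree₁]; push_cast; ring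
    · push_cast; ring

theorem exists_eq_three_mul_add {n r : ℕ} (hr : r < 3) (hn : n ≡ r [MOD 3]) :
    ∃ k, n = 3 * k + r :=
  ⟨n / 3, by rw [← Nat.mod_eq_of_lt hr, ← hn, Nat.div_add_mod]⟩

section Values

variable {n : ℕ}

theorem rootCoeff_zero_of_modEq_zero (hn : n ≡ 0 [MOD 3]) : rootCoeff n 0 = 0 := by
  obtain ⟨k, rfl⟩ := exists_eq_three_mul_add three_pos hn
  exact (rootCoeff_three_mul_add k).1.1

theorem rootCoeff_one_of_modEq_zero (hn : n ≡ 0 [MOD 3]) : rootCoeff n 1 = -n / 4 := by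
  obtain ⟨k, rfl⟩ := exists_eq_three_mul_add three_pos hn
  exact (rootCoeff_three_mul_add k).1.2

theorem rootCoeff_zero_of_modEq_one (hn : n ≡ 1 [MOD 3]) : rootCoeff n 0 = 1 := by
  obtain ⟨k, rfl⟩ := exists_eq_three_mul_add (by norm_num) hn
  exact (rootCoeff_three_mul_add k).2.1

theorem rootCoeff_one_of_modEq_one (hn : n ≡ 1 [MOD 3]) : rootCoeff n 1 = 0 := by
  simpa [rootCoeff_zero_of_modEq_one hn] using rootCoeff_zero_mul_rootCoeff_one n

theorem rootCoeff_zero_of_modEq_two (hn : n ≡ 2 [MOD 3]) : rootCoeff n 0 = 0 := by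
  obtain ⟨k, rfl⟩ := exists_eq_three_mul_add (by norm_num) hn
  exact (rootCoeff_three_mul_add k).2.2.1

theorem rootCoeff_one_of_modEq_two (hn : n ≡ 2 [MOD 3]) : rootCoeff n 1 = (n + 1) / 4 := by
  obtain ⟨k, rfl⟩ := exists_eq_three_mul_add (by norm_num) hn
  rw [(rootCoeff_three_mul_add k).2.2.2]
  push_cast
  ring

theorem rootCoeff_two_of_modEq_zero (hn : n ≡ 0 [MOD 3]) :
    rootCoeff n 2 = -(n * (2 * n + 1)) / 80 := by
  have h := rootCoeff_two_eq n
  rw [rootCoeff_zero_of_modEq_zero hn, rootCoeff_one_of_modEq_zero hn] at h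
  linear_combination h / 20

theorem rootCoeff_two_of_modEq_two (hn : n ≡ 2 [MOD 3]) :
    rootCoeff n 2 = -((n + 1) * (2 * n + 1)) / 80 := by
  have h := rootCoeff_two_eq n
  rw [rootCoeff_zero_of_modEq_two hn, rootCoeff_one_of_modEq_two hn] at h
  linear_combination h / 20

theorem rootCoeff_two_of_modEq_one (hn : n ≡ 1 [MOD 3]) :
    rootCoeff n 2 = (n - 1) * (n + 2) / 560 := by
  have hsucc : n + 1 ≡ 2 [MOD 3] := hn.add_right 1
  have h := rootCoeff_add_rootCoeff n 2
  simp only [Finset.Nat.sum_antidiagonal_eq_sum_range_succ_mk, Finset.sum_range_succ,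
    Finset.sum_range_zero, Nat.reduceSub, tsub_zero, Nat.cast_ofNat,
    rootCoeff_zero_of_modEq_one hn, rootCoeff_one_of_modEq_one hn,
    rootCoeff_zero_of_modEq_two hsucc, rootCoeff_one_of_modEq_two hsucc,
    rootCoeff_two_of_modEq_two hsucc] at h
  push_cast at h
  linear_combination h / 7

theorem rootCoeff_three_of_modEq_zero (hn : n ≡ 0 [MOD 3]) :
    rootCoeff n 3 = -(n * (2 * n + 1) * (5 * n + 1)) / 4480 := by
  have h := rootCoeff_three_eq n
  rw [rootCoeff_zero_of_modEq_zero hn, rootCoeff_one_of_modEq_zero hn,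
    rootCoeff_two_of_modEq_zero hn] at h
  linear_combination h / 56

theorem rootCoeff_three_of_modEq_one (hn : n ≡ 1 [MOD 3]) :
    rootCoeff n 3 = (n - 1) * (n + 2) / 22400 := by
  have h := rootCoeff_three_eq n
  rw [rootCoeff_zero_of_modEq_one hn, rootCoeff_one_of_modEq_one hn,
    rootCoeff_two_of_modEq_one hn] at h
  linear_combination h / 40

theorem rootCoeff_three_of_modEq_two (hn : n ≡ 2 [MOD 3]) :
    rootCoeff n 3 = (n + 1) * (2 * n + 1) * (5 * n + 4) / 4480 := by
  have h := rootCoeff_three_eq n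
  rw [rootCoeff_zero_of_modEq_two hn, rootCoeff_one_of_modEq_two hn,
    rootCoeff_two_of_modEq_two hn] at h
  linear_combination h / 56

end Values

section PolynomialDependence

/-- The functions `ℕ → ℂ` of the form `n ↦ P n` with `P` a polynomial with rational
coefficients. -/
def ratPolynomialFunctions : Subalgebra ℚ (ℕ → ℂ) :=
  (aeval fun n : ℕ => (n : ℂ)).range

variable {f g : ℕ → ℂ}

theorem mem_ratPolynomialFunctions :
    f ∈ ratPolynomialFunctions ↔ ∃ P : ℚ[X], ∀ n : ℕ, f n = (P.eval (n : ℚ) : ℚ) := by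
  have haeval (P : ℚ[X]) (n : ℕ) :
      aeval (fun n : ℕ => (n : ℂ)) P n = (P.eval (n : ℚ) : ℚ) := by
    rw [aeval_pi_apply₂, ← eq_ratCast (algebraMap ℚ ℂ),
      ← aeval_algebraMap_apply_eq_algebraMap_eval, map_natCast]
  simp only [ratPolynomialFunctions, AlgHom.mem_range, funext_iff, haeval, eq_comm]

theorem rat_mul_mem_ratPolynomialFunctions (q : ℚ) (hf : f ∈ ratPolynomialFunctions) :
    (fun n => q * f n) ∈ ratPolynomialFunctions := by
  simpa only [Rat.smul_def] using! Subalgebra.smul_mem _ hf q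

theorem mem_ratPolynomialFunctions_of_mul_eq {q : ℚ} (hq : q ≠ 0)
    (hg : g ∈ ratPolynomialFunctions) (h : ∀ n, q * f n = g n) : f ∈ ratPolynomialFunctions := by
  have hf : f = fun n => (q⁻¹ : ℚ) * g n := by
    ext n
    rw [← h, Rat.cast_inv, inv_mul_cancel_left₀ (Rat.cast_ne_zero.2 hq)]
  exact hf ▸ rat_mul_mem_ratPolynomialFunctions _ hg

theorem sum_mem_ratPolynomialFunctions {ι : Type*} {s : Finset ι} {f : ι → ℕ → ℂ}
    (hf : ∀ i ∈ s, f i ∈ ratPolynomialFunctions) :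
    (fun n => ∑ i ∈ s, f i n) ∈ ratPolynomialFunctions := by
  simpa only [← Finset.sum_fn] using sum_mem hf

theorem rootCoeff_add_two_of_zero {n : ℕ} (h₀ : rootCoeff n 0 = 0) (k : ℕ) :
    (3 * k + 5) * (3 * k + 4) * (3 * k + 3) * rootCoeff n (k + 2) =
      (3 * k + 3) * rootCoeff n (k + 1) - 6 * ∑ ij ∈ antidiagonal k,
        (3 * ij.1 + 2) * rootCoeff n (ij.1 + 1) * ((3 * ij.2 + 2) * rootCoeff n (ij.2 + 1)) := by
  have h := rootCoeff_toda_chain n (k + 1)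
  rw [Finset.Nat.sum_antidiagonal_succ, Finset.Nat.sum_antidiagonal_succ', h₀] at h
  push_cast at h
  have hshift (i : ℕ) : (3 * (i + 1) - 1 : ℂ) = 3 * i + 2 := by ring
  simp only [hshift] at h
  linear_combination h

theorem rootCoeff_add_two_of_one {n : ℕ} (h₀ : rootCoeff n 0 = 1)
    (hsucc : rootCoeff (n + 1) 0 = 0) (k : ℕ) :
    (3 * k + 7) * rootCoeff n (k + 2) =
      -((3 * k + 3) * rootCoeff (n + 1) (k + 2)) - ∑ ij ∈ antidiagonal k,
        (rootCoeff n (ij.1 + 1) - rootCoeff (n + 1) (ij.1 + 1)) *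
          (rootCoeff n (ij.2 + 1) - rootCoeff (n + 1) (ij.2 + 1)) := by
  have h := rootCoeff_add_rootCoeff n (k + 2)
  rw [Finset.Nat.sum_antidiagonal_succ, Finset.Nat.sum_antidiagonal_succ', h₀, hsucc] at h
  push_cast at h
  linear_combination h

variable {ν : ℕ → ℕ}

theorem rootCoeff_mem_ratPolynomialFunctions_of_zero (h₀ : ∀ j, rootCoeff (ν j) 0 = 0)
    (h₁ : (fun j => rootCoeff (ν j) 1) ∈ ratPolynomialFunctions) (k : ℕ) :
    (fun j => rootCoeff (ν j) k) ∈ ratPolynomialFunctions := by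
  induction k using Nat.strong_induction_on with
  | _ k ih =>
  match k with
  | 0 => simpa only [h₀] using! zero_mem _
  | 1 => exact h₁
  | k + 2 =>
    refine mem_ratPolynomialFunctions_of_mul_eq
      (q := (3 * k + 5) * (3 * k + 4) * (3 * k + 3)) (by positivity) (sub_mem
        (rat_mul_mem_ratPolynomialFunctions (3 * k + 3) (ih (k + 1) (by omega)))
        (rat_mul_mem_ratPolynomialFunctions 6
          (sum_mem_ratPolynomialFunctions (s := antidiagonal k) fun ij hij => mul_mem
            (rat_mul_mem_ratPolynomialFunctions (3 * ij.1 + 2) (ih (ij.1 + 1) ?_))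
            (rat_mul_mem_ratPolynomialFunctions (3 * ij.2 + 2) (ih (ij.2 + 1) ?_)))))
      fun j => ?_
    · exact Nat.succ_lt_succ (Finset.Nat.antidiagonal.fst_lt hij)
    · exact Nat.succ_lt_succ (Finset.Nat.antidiagonal.snd_lt hij)
    · simpa using! rootCoeff_add_two_of_zero (h₀ j) k

theorem rootCoeff_mem_ratPolynomialFunctions_of_one (h₀ : ∀ j, rootCoeff (ν j) 0 = 1)
    (hsucc₀ : ∀ j, rootCoeff (ν j + 1) 0 = 0)
    (hsucc : ∀ k, (fun j => rootCoeff (ν j + 1) k) ∈ ratPolynomialFunctions) (k : ℕ) :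
    (fun j => rootCoeff (ν j) k) ∈ ratPolynomialFunctions := by
  induction k using Nat.strong_induction_on with
  | _ k ih =>
  match k with
  | 0 => simpa only [h₀] using! one_mem _
  | 1 =>
    have h₁ (j : ℕ) : rootCoeff (ν j) 1 = 0 := by
      simpa [h₀] using rootCoeff_zero_mul_rootCoeff_one (ν j)
    simpa only [h₁] using! zero_mem _
  | k + 2 =>
    refine mem_ratPolynomialFunctions_of_mul_eq (q := 3 * k + 7) (by positivity) (sub_mem
        (neg_mem (rat_mul_mem_ratPolynomialFunctions (3 * k + 3) (hsucc (k + 2))))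
        (sum_mem_ratPolynomialFunctions (s := antidiagonal k) fun ij hij => mul_mem
          (sub_mem (ih (ij.1 + 1) ?_) (hsucc (ij.1 + 1)))
          (sub_mem (ih (ij.2 + 1) ?_) (hsucc (ij.2 + 1)))))
      fun j => ?_
    · exact Nat.succ_lt_succ (Finset.Nat.antidiagonal.fst_lt hij)
    · exact Nat.succ_lt_succ (Finset.Nat.antidiagonal.snd_lt hij)
    · simpa using! rootCoeff_add_two_of_one (h₀ j) (hsucc₀ j) k

theorem three_mul_add_modEq (j r : ℕ) : 3 * j + r ≡ r [MOD 3] :=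
  Nat.modEq_iff_dvd.2 ⟨-j, by push_cast; ring⟩

theorem rootCoeff_three_mul_add_mem_ratPolynomialFunctions {r : ℕ} (hr : r < 3) (k : ℕ) :
    (fun j => rootCoeff (3 * j + r) k) ∈ ratPolynomialFunctions := by
  have hmod := three_mul_add_modEq
  have htwo (k : ℕ) : (fun j => rootCoeff (3 * j + 2) k) ∈ ratPolynomialFunctions := by
    refine rootCoeff_mem_ratPolynomialFunctions_of_zero
      (fun j => rootCoeff_zero_of_modEq_two (hmod j 2))
      (mem_ratPolynomialFunctions.2 ⟨C (3 / 4) * (X + 1), fun j => ?_⟩) k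
    rw [rootCoeff_one_of_modEq_two (hmod j 2), eval_mul, eval_C, eval_add, eval_X, eval_one]
    push_cast
    ring
  interval_cases r
  · refine rootCoeff_mem_ratPolynomialFunctions_of_zero
      (fun j => rootCoeff_zero_of_modEq_zero (hmod j 0))
      (mem_ratPolynomialFunctions.2 ⟨C (-3 / 4) * X, fun j => ?_⟩) k
    rw [rootCoeff_one_of_modEq_zero (hmod j 0), eval_mul, eval_C, eval_X]
    push_cast
    ring
  · exact rootCoeff_mem_ratPolynomialFunctions_of_one
      (fun j => rootCoeff_zero_of_modEq_one (hmod j 1))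
      (fun j => rootCoeff_zero_of_modEq_two (hmod j 2)) htwo k
  · exact htwo k

theorem exists_polynomial_rootCoeff {r : ℕ} (hr : r < 3) (k : ℕ) :
    ∃ P : ℚ[X], ∀ n : ℕ, n ≡ r [MOD 3] → rootCoeff n k = (P.eval (n : ℚ) : ℚ) := by
  obtain ⟨P, hP⟩ := mem_ratPolynomialFunctions.1
    (rootCoeff_three_mul_add_mem_ratPolynomialFunctions hr k)
  refine ⟨P.comp (C (1 / 3) * (X - C (r : ℚ))), fun n hn => ?_⟩
  obtain ⟨j, rfl⟩ := exists_eq_three_mul_add hr hn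
  rw [hP, eval_comp]
  simp

end PolynomialDependence

section PowerSums

variable {n m : ℕ}

theorem inversePowerSum_three_mul (n : ℕ) {k : ℕ} (hk : k ≠ 0) :
    inversePowerSum n (3 * k) = -rootCoeff n k :=
  inversePowerSum_eq_neg_coeff (mul_ne_zero three_ne_zero hk)

theorem inversePowerSum_three (n : ℕ) :
    (n ≡ 0 [MOD 3] → inversePowerSum n 3 = (n : ℂ) / 4) ∧
      (n ≡ 1 [MOD 3] → inversePowerSum n 3 = 0) ∧
      (n ≡ 2 [MOD 3] → inversePowerSum n 3 = -((n : ℂ) + 1) / 4) := by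
  have h : inversePowerSum n 3 = -rootCoeff n 1 :=
    inversePowerSum_three_mul n (k := 1) one_ne_zero
  rw [h]
  refine ⟨fun hn => ?_, fun hn => ?_, fun hn => ?_⟩
  · rw [rootCoeff_one_of_modEq_zero hn]; ring
  · rw [rootCoeff_one_of_modEq_one hn, neg_zero]
  · rw [rootCoeff_one_of_modEq_two hn]; ring

theorem inversePowerSum_six (n : ℕ) :
    (n ≡ 0 [MOD 3] → inversePowerSum n 6 = 1 / 40 * (n : ℂ) ^ 2 + 1 / 80 * (n : ℂ)) ∧
      (n ≡ 1 [MOD 3] → inversePowerSum n 6 =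
        -(1 / 560) * (n : ℂ) ^ 2 - 1 / 560 * (n : ℂ) + 1 / 280) ∧
      (n ≡ 2 [MOD 3] → inversePowerSum n 6 =
        1 / 40 * (n : ℂ) ^ 2 + 3 / 80 * (n : ℂ) + 1 / 80) := by
  have h : inversePowerSum n 6 = -rootCoeff n 2 :=
    inversePowerSum_three_mul n (k := 2) two_ne_zero
  rw [h]
  refine ⟨fun hn => ?_, fun hn => ?_, fun hn => ?_⟩
  · rw [rootCoeff_two_of_modEq_zero hn]; ring
  · rw [rootCoeff_two_of_modEq_one hn]; ring
  · rw [rootCoeff_two_of_modEq_two hn]; ring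

theorem inversePowerSum_nine (n : ℕ) :
    (n ≡ 0 [MOD 3] → inversePowerSum n 9 =
        ((n : ℂ) + 7 * (n : ℂ) ^ 2 + 10 * (n : ℂ) ^ 3) / 4480) ∧
      (n ≡ 1 [MOD 3] → inversePowerSum n 9 = (2 - (n : ℂ) - (n : ℂ) ^ 2) / 22400) ∧
      (n ≡ 2 [MOD 3] → inversePowerSum n 9 =
        (-20 - 85 * (n : ℂ) - 115 * (n : ℂ) ^ 2 - 50 * (n : ℂ) ^ 3) / 22400) := by
  have h : inversePowerSum n 9 = -rootCoeff n 3 :=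
    inversePowerSum_three_mul n (k := 3) three_ne_zero
  rw [h]
  refine ⟨fun hn => ?_, fun hn => ?_, fun hn => ?_⟩
  · rw [rootCoeff_three_of_modEq_zero hn]; ring
  · rw [rootCoeff_three_of_modEq_one hn]; ring
  · rw [rootCoeff_three_of_modEq_two hn]; ring

theorem inversePowerSum_eq_zero_of_not_three_dvd (hm : ¬3 ∣ m) (n : ℕ) :
    inversePowerSum n m = 0 := by
  rw [inversePowerSum_eq_neg_coeff (by rintro rfl; exact hm (dvd_zero 3)),
    coeff_rootSeries_eq_zero hm, neg_zero]

theorem inversePowerSum_zero (n : ℕ) :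
    inversePowerSum n 0 = (((yablonskiiVorobev n).aroots ℂ).filter (· ≠ 0)).card := by
  simp [inversePowerSum]

theorem exists_polynomial_inversePowerSum (hm : 0 < m) (hdvd : 3 ∣ m) {r : ℕ} (hr : r < 3) :
    ∃ P : ℚ[X], ∀ n : ℕ, n ≡ r [MOD 3] →
      inversePowerSum n m = ((P.eval (n : ℚ) : ℚ) : ℂ) := by
  obtain ⟨k, rfl⟩ := hdvd
  obtain ⟨P, hP⟩ := exists_polynomial_rootCoeff hr k
  refine ⟨-P, fun n hn => ?_⟩
  rw [inversePowerSum_three_mul n (by omega), hP n hn, eval_neg, Rat.cast_neg]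

theorem exists_rat_inversePowerSum (n m : ℕ) : ∃ q : ℚ, inversePowerSum n m = q := by
  rcases m.eq_zero_or_pos with rfl | hm
  · exact ⟨_, (inversePowerSum_zero n).trans (Rat.cast_natCast _).symm⟩
  by_cases hdvd : 3 ∣ m
  · obtain ⟨P, hP⟩ := exists_polynomial_inversePowerSum hm hdvd (n.mod_lt three_pos)
    exact ⟨_, hP n (n.mod_modEq 3).symm⟩
  · exact ⟨0, by rw [inversePowerSum_eq_zero_of_not_three_dvd hdvd, Rat.cast_zero]⟩

end PowerSums

end

theorem mainTheorem5 :
    -- the division in the recurrence is exact, for every `n`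
    (∀ n : ℕ, yablonskiiVorobev (n + 2) * yablonskiiVorobev n =
      X * yablonskiiVorobev (n + 1) ^ 2
        - 4 * (yablonskiiVorobev (n + 1) * derivative (derivative (yablonskiiVorobev (n + 1)))
          - derivative (yablonskiiVorobev (n + 1)) ^ 2)) ∧
    -- inverse third powers
    (∀ n : ℕ,
      (n ≡ 0 [MOD 3] → inversePowerSum n 3 = (n : ℂ) / 4) ∧
      (n ≡ 1 [MOD 3] → inversePowerSum n 3 = 0) ∧
      (n ≡ 2 [MOD 3] → inversePowerSum n 3 = -((n : ℂ) + 1) / 4)) ∧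
    -- inverse sixth powers
    (∀ n : ℕ,
      (n ≡ 0 [MOD 3] → inversePowerSum n 6 = 1 / 40 * (n : ℂ) ^ 2 + 1 / 80 * (n : ℂ)) ∧
      (n ≡ 1 [MOD 3] → inversePowerSum n 6 =
        -(1 / 560) * (n : ℂ) ^ 2 - 1 / 560 * (n : ℂ) + 1 / 280) ∧
      (n ≡ 2 [MOD 3] → inversePowerSum n 6 =
        1 / 40 * (n : ℂ) ^ 2 + 3 / 80 * (n : ℂ) + 1 / 80)) ∧
    -- inverse ninth powers
    (∀ n : ℕ,
      (n ≡ 0 [MOD 3] → inversePowerSum n 9 =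
        ((n : ℂ) + 7 * (n : ℂ) ^ 2 + 10 * (n : ℂ) ^ 3) / 4480) ∧
      (n ≡ 1 [MOD 3] → inversePowerSum n 9 = (2 - (n : ℂ) - (n : ℂ) ^ 2) / 22400) ∧
      (n ≡ 2 [MOD 3] → inversePowerSum n 9 =
        (-20 - 85 * (n : ℂ) - 115 * (n : ℂ) ^ 2 - 50 * (n : ℂ) ^ 3) / 22400)) ∧
    -- for every positive multiple `m` of `3`: a rational polynomial in `n` for each class mod `3`
    (∀ m : ℕ, 0 < m → 3 ∣ m → ∀ r : ℕ, r < 3 → ∃ P : ℚ[X], ∀ n : ℕ, n ≡ r [MOD 3] →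
      inversePowerSum n m = ((P.eval (n : ℚ) : ℚ) : ℂ)) ∧
    -- for `m` not divisible by `3` the sum vanishes
    (∀ m : ℕ, ¬ 3 ∣ m → ∀ n : ℕ, inversePowerSum n m = 0) ∧
    -- all sums are rational
    (∀ n m : ℕ, ∃ q : ℚ, inversePowerSum n m = (q : ℂ)) :=
  ⟨yablonskiiVorobev_add_two_mul, inversePowerSum_three, inversePowerSum_six, inversePowerSum_nine,
    fun _ hm hdvd _ hr => exists_polynomial_inversePowerSum hm hdvd hr,
    fun _ hm => inversePowerSum_eq_zero_of_not_three_dvd hm, exists_rat_inversePowerSum⟩
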